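/- Let $X$ be a (real or complex) Banach space, with bidual $X^{**}$ and canonical embedding $J_X : X \to X^{**}$. Call a Banach space $Y$ coreflexive if the quotient Banach space $Y^{**}/J_Y(Y)$ is reflexive. Suppose that $X$ is w$^*$-sequentially dense in $X^{**}$, that is, for every $x^{**}\in X^{**}$ there is a sequence $(x_n)_{n\in\mathbb N}$ in $X$ such that $J_X(x_n)\to x^{**}$ in the w$^*$-topology of $X^{**}$. If every closed separable subspace $Y\subseteq X$ is coreflexive, then $X$ is coreflexive. -/

import Mathlib

-- the value that Mathlib itself is built with (needed to find the quotient of a bidual)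
set_option maxSynthPendingDepth 3

open Filter Topology

/-- A normed space `E` is reflexive if the canonical embedding `J_E : E → E**` is onto.
(Seminormed spaces are allowed only so that quotients need no closedness instance.) -/
def IsReflexiveSpace (𝕜 : Type*) [RCLike 𝕜] (E : Type*) [SeminormedAddCommGroup E]
    [NormedSpace 𝕜 E] : Prop :=
  Function.Surjective (NormedSpace.inclusionInDoubleDual 𝕜 E)

/-- The canonical image `J_X(X)` of `X` in its bidual `X**`, as a linear subspace. -/
noncomputable def canonicalImage (𝕜 : Type*) [RCLike 𝕜] (X : Type*) [NormedAddCommGroup X]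
    [NormedSpace 𝕜 X] : Submodule 𝕜 (StrongDual 𝕜 (StrongDual 𝕜 X)) :=
  (NormedSpace.inclusionInDoubleDual 𝕜 X).range

/-- For a Banach space `X`, the subspace `J_X(X)` is closed, so that the quotient seminorm on
`X** / J_X(X)` is a norm. -/
theorem isClosed_canonicalImage (𝕜 : Type*) [RCLike 𝕜] (X : Type*) [NormedAddCommGroup X]
    [NormedSpace 𝕜 X] [CompleteSpace X] :
    IsClosed (canonicalImage 𝕜 X : Set (StrongDual 𝕜 (StrongDual 𝕜 X))) :=
  (NormedSpace.inclusionInDoubleDualLi (E := X) 𝕜).isometry.isUniformInducing.isComplete_range.isClosed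

/-- `X` is coreflexive if `X** / X`, with the quotient norm, is reflexive. -/
def IsCoreflexive (𝕜 : Type*) [RCLike 𝕜] (X : Type*) [NormedAddCommGroup X]
    [NormedSpace 𝕜 X] : Prop :=
  IsReflexiveSpace 𝕜 (StrongDual 𝕜 (StrongDual 𝕜 X) ⧸ canonicalImage 𝕜 X)

/-- `X` is w*-sequentially dense in `X**`: every element of `X**` is the w*-limit of a sequence
of elements of (the canonical image of) `X`. -/
def IsWeakStarSeqDenseInBidual (𝕜 : Type*) [RCLike 𝕜] (X : Type*) [NormedAddCommGroup X]
    [NormedSpace 𝕜 X] : Prop :=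
  ∀ z : StrongDual 𝕜 (StrongDual 𝕜 X), ∃ x : ℕ → X,
    Tendsto (fun n => StrongDual.toWeakDual (NormedSpace.inclusionInDoubleDual 𝕜 X (x n)))
      atTop (𝓝 (StrongDual.toWeakDual z))

/-! Reflexivity is tested on bounded sequences (`isReflexiveSpace_of_forall_bounded_seq`), and a
sequence in X**/X involves only a separable part of X. Lift its terms to X**, take sequences in X
that w*-converge to the lifts, and let Y be their closed span. The lifts come boundedly from Y**
(`Submodule.exists_bidualInclusion_eq`), so the sequence is the image of a bounded one in Y**/Y.
That one converges weakly along an ultrafilter, and bounded operators preserve this. -/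

section Reflexivity

variable {𝕜 : Type*} [RCLike 𝕜] {E : Type*} [SeminormedAddCommGroup E] [NormedSpace 𝕜 E]

/-- A point outside the closure of a subspace is separated from it by a functional vanishing on
the subspace. -/
theorem exists_strongDual_ne_zero_of_notMem_closure (S : Submodule 𝕜 E) {x : E}
    (hx : x ∉ closure (S : Set E)) :
    ∃ f : StrongDual 𝕜 E, f x ≠ 0 ∧ ∀ y ∈ S, f y = 0 := by
  obtain ⟨g, -, hg⟩ := exists_dual_vector'' 𝕜 (S.mkQ x)
  refine ⟨g.comp S.mkQL, ?_, fun y hy => ?_⟩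
  · have h : ‖S.mkQ x‖ ≠ 0 := fun h =>
      hx ((QuotientAddGroup.norm_mk_eq_zero_iff_mem_closure (S := S.toAddSubgroup)).1 h)
    have : g (S.mkQ x) ≠ 0 := by rw [hg]; exact_mod_cast h
    simpa using this
  · have : S.mkQ y = 0 := by simpa using hy
    simp only [ContinuousLinearMap.comp_apply, Submodule.mkQL_apply, this, map_zero]

/-- A functional on the dual that is not an evaluation stays bounded away from zero on the
annihilator of each finite set. -/
theorem exists_annihilating_of_notMem_range [CompleteSpace E]
    {F : StrongDual 𝕜 (StrongDual 𝕜 E)}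
    (hF : F ∉ Set.range (NormedSpace.inclusionInDoubleDual 𝕜 E)) :
    ∃ C : ℝ, 0 < C ∧ ∀ s : Finset E, ∃ f : StrongDual 𝕜 E,
      ‖f‖ ≤ C ∧ F f = 1 ∧ ∀ x ∈ s, f x = 0 := by
  have hcl : IsClosed (Set.range (NormedSpace.inclusionInDoubleDual 𝕜 E)) :=
    (NormedSpace.inclusionInDoubleDualLi (E := E)
      𝕜).isometry.isUniformInducing.isComplete_range.isClosed
  obtain ⟨d, hd, hball⟩ := Metric.isOpen_iff.1 hcl.isOpen_compl F hF
  refine ⟨2 / d, by positivity, fun s => ?_⟩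
  let N : Submodule 𝕜 (StrongDual 𝕜 E) :=
    ⨅ x : s, (NormedSpace.inclusionInDoubleDual 𝕜 E x).ker
  have hN : ∀ f ∈ N, ∀ x ∈ s, f x = 0 := fun f hf x hx => by
    simpa using (Submodule.mem_iInf _).1 hf ⟨x, hx⟩
  -- Otherwise a Hahn–Banach extension `G` of `F` restricted to `N` has norm below `d`, and `F - G`,
  -- which kills `N`, is a combination of evaluations.
  have hnorm : d ≤ ‖F.comp N.subtypeL‖ := by
    by_contra! hlt
    obtain ⟨G, hG, hGn⟩ := exists_extension_norm_eq N (F.comp N.subtypeL)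
    have hspan : (F - G).toLinearMap ∈ Submodule.span 𝕜
        (Set.range fun x : s => (NormedSpace.inclusionInDoubleDual 𝕜 E x).toLinearMap) := by
      refine mem_span_of_iInf_ker_le_ker fun f hf => ?_
      simpa [sub_eq_zero] using (hG ⟨f, hf⟩).symm
    obtain ⟨c, hc⟩ := (Submodule.mem_span_range_iff_exists_fun 𝕜).1 hspan
    have hFG : F - G ∈ Metric.ball F d := by
      rw [Metric.mem_ball, dist_eq_norm, sub_sub_cancel_left, norm_neg, hGn]
      exact hlt
    refine hball hFG ⟨∑ x : s, c x • (x : E), ?_⟩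
    ext f
    have := LinearMap.congr_fun hc f
    simpa using this
  obtain ⟨f, hf⟩ : ∃ f : N, d / 2 * ‖f‖ < ‖F f‖ := by
    by_contra! h
    have := (F.comp N.subtypeL).opNorm_le_bound (by positivity) h
    linarith
  have hpos : 0 < ‖F f‖ := lt_of_le_of_lt (by positivity) hf
  refine ⟨(F f)⁻¹ • (f : StrongDual 𝕜 E), ?_, ?_, fun x hx => ?_⟩
  · rw [norm_smul, norm_inv, inv_mul_le_iff₀ hpos, mul_div_assoc', le_div_iff₀ hd]
    have : ‖(f : StrongDual 𝕜 E)‖ = ‖f‖ := rfl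
    rw [this]
    linarith
  · simp [norm_pos_iff.1 hpos]
  · simp [hN f f.2 x hx]

/-- Helly's theorem, approximate form: on finitely many functionals, an element of the bidual is
approximated by evaluations at points of norm at most `‖F‖ + 1`. -/
theorem exists_norm_le_forall_norm_apply_sub_le (F : StrongDual 𝕜 (StrongDual 𝕜 E))
    (s : Finset (StrongDual 𝕜 E)) {ε : ℝ} (hε : 0 < ε) :
    ∃ x : E, ‖x‖ ≤ ‖F‖ + 1 ∧ ∀ f ∈ s, ‖f x - F f‖ ≤ ε := by
  classical
  let _ : NormedSpace ℝ E := .restrictScalars ℝ 𝕜 E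
  have : IsScalarTower ℝ 𝕜 E := .restrictScalars _ _ _
  let T : E →L[𝕜] (s → 𝕜) := ContinuousLinearMap.pi fun f => (f : StrongDual 𝕜 E)
  let R := ‖F‖ + 1
  have hR : 0 < R := by positivity
  suffices h : (fun f : s => F f) ∈ closure (T '' Metric.closedBall 0 R) by
    obtain ⟨_, ⟨x, hx, rfl⟩, hxd⟩ := Metric.mem_closure_iff.1 h ε hε
    refine ⟨x, by simpa using hx, fun f hf => ?_⟩
    have := ((dist_pi_lt_iff hε).1 hxd ⟨f, hf⟩).le
    rwa [dist_comm, dist_eq_norm] at this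
  by_contra hmem
  have hconv : Convex ℝ (closure (T '' Metric.closedBall 0 R)) :=
    ((convex_closedBall (0 : E) R).linear_image (T.toLinearMap.restrictScalars ℝ)).closure
  obtain ⟨φ, u, hφ, hu⟩ :=
    RCLike.geometric_hahn_banach_closed_point (𝕜 := 𝕜) hconv isClosed_closure hmem
  have hball : ∀ x : E, ‖x‖ ≤ R → RCLike.re (φ (T x)) < u := fun x hx =>
    hφ _ (subset_closure ⟨x, by simpa using hx, rfl⟩)
  have hφF : φ (fun f : s => F f) = F (φ.comp T) := by
    have hcomp : φ.comp T =
        ∑ f : s, φ (fun g => if f = g then 1 else 0) • (f : StrongDual 𝕜 E) := by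
      ext x
      have := LinearMap.pi_apply_eq_sum_univ φ.toLinearMap (T x)
      simpa [T, mul_comm] using this
    have := LinearMap.pi_apply_eq_sum_univ φ.toLinearMap (fun f : s => F f)
    rw [hcomp, map_sum]
    simpa [mul_comm] using this
  have hu0 : 0 < u := by simpa using hball 0 (by simpa using hR.le)
  have hnorm : ‖φ.comp T‖ ≤ u / R := by
    refine ContinuousLinearMap.opNorm_le_of_unit_norm (by positivity) fun x hx => ?_
    -- Rotating `x` by `c` turns the bound on real parts into one on norms.
    obtain ⟨c, hc, hcx⟩ := RCLike.exists_norm_eq_mul_self (φ (T x))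
    have := hball (((R : 𝕜) * c) • x) (by simp [norm_smul, hc, hx, abs_of_pos hR])
    rw [map_smul, map_smul, smul_eq_mul, mul_assoc, ← hcx, ← RCLike.ofReal_mul,
      RCLike.ofReal_re] at this
    rw [le_div_iff₀ hR, ContinuousLinearMap.comp_apply]
    linarith
  have h1 : ‖F (φ.comp T)‖ ≤ R * (u / R) :=
    (F.le_opNorm _).trans (by gcongr; simp [R])
  rw [mul_div_cancel₀ _ hR.ne'] at h1
  rw [hφF] at hu
  linarith [RCLike.re_le_norm (F (φ.comp T))]

/-- If every bounded sequence of a complete space converges weakly along some nonprincipal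
ultrafilter, then the space is reflexive. -/
theorem isReflexiveSpace_of_forall_bounded_seq [CompleteSpace E]
    (h : ∀ (x : ℕ → E) (R : ℝ), (∀ n, ‖x n‖ ≤ R) → ∃ y : E, ∀ f : StrongDual 𝕜 E,
      Tendsto (fun n => f (x n)) (hyperfilter ℕ) (𝓝 (f y))) :
    IsReflexiveSpace 𝕜 E := by
  intro F
  by_contra hF
  obtain ⟨C, hC, hann⟩ := exists_annihilating_of_notMem_range hF
  -- Each functional kills the earlier points and is nearly 1 on the later ones. A weak limit `y` is
  -- then nearly 1 under every functional, yet lies in the closed span, where they tend to 0.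
  obtain ⟨p, hp, hpr⟩ := exists_seq_of_forall_finset_exists
    (fun p : StrongDual 𝕜 E × E => ‖p.1‖ ≤ C ∧ ‖p.2‖ ≤ ‖F‖ + 1 ∧ F p.1 = 1)
    (fun p q => q.1 p.2 = 0 ∧ ‖p.1 q.2 - 1‖ ≤ 1 / 4) (by
      classical
      intro s hs
      obtain ⟨f, hfC, hfF, hf⟩ := hann (s.image Prod.snd)
      obtain ⟨x, hx, hxs⟩ :=
        exists_norm_le_forall_norm_apply_sub_le F (s.image Prod.fst) (ε := 1 / 4) (by norm_num)
      refine ⟨(f, x), ⟨hfC, hx, hfF⟩, fun p hps => ⟨hf _ (Finset.mem_image_of_mem _ hps), ?_⟩⟩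
      simpa [(hs p hps).2.2] using hxs _ (Finset.mem_image_of_mem _ hps))
  obtain ⟨y, hy⟩ := h (fun n => (p n).2) _ fun n => (hp n).2.1
  have hyn : ∀ n, ‖(p n).1 y - 1‖ ≤ 1 / 4 := fun n =>
    le_of_tendsto (((hy (p n).1).sub_const 1).norm)
      (((eventually_gt_atTop n).filter_mono Nat.hyperfilter_le_atTop).mono
        fun m hm => (hpr n m hm).2)
  have hycl : y ∈ closure (Submodule.span 𝕜 (Set.range fun n => (p n).2) : Set E) := by
    by_contra hy'
    obtain ⟨f, hfy, hf⟩ := exists_strongDual_ne_zero_of_notMem_closure _ hy'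
    refine hfy (tendsto_nhds_unique (hy f) ?_)
    simp [hf _ (Submodule.subset_span (Set.mem_range_self _))]
  obtain ⟨w, hw, hyw⟩ := Metric.mem_closure_iff.1 hycl (1 / (4 * C)) (by positivity)
  have hvanish : ∃ m, ∀ n ≥ m, (p n).1 w = 0 := by
    refine Submodule.span_induction (p := fun w _ => ∃ m, ∀ n ≥ m, (p n).1 w = 0)
      ?_ ⟨0, by simp⟩ ?_ ?_ hw
    · rintro _ ⟨m, rfl⟩
      exact ⟨m + 1, fun n hn => (hpr m n hn).1⟩
    · rintro a b - - ⟨m, hm⟩ ⟨k, hk⟩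
      exact ⟨max m k, fun n hn => by
        simp [hm n (le_of_max_le_left hn), hk n (le_of_max_le_right hn)]⟩
    · rintro c a - ⟨m, hm⟩
      exact ⟨m, fun n hn => by simp [hm n hn]⟩
  obtain ⟨m, hm⟩ := hvanish
  have h1 : ‖(p m).1 y‖ ≤ 1 / 4 := by
    calc ‖(p m).1 y‖ = ‖(p m).1 (y - w)‖ := by simp [hm m le_rfl]
      _ ≤ C * (1 / (4 * C)) := by
        refine ((p m).1.le_opNorm _).trans ?_
        gcongr
        · exact (hp m).1
        · rw [← dist_eq_norm]; exact hyw.le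
      _ = 1 / 4 := by field_simp
  have h2 := norm_sub_norm_le (1 : 𝕜) ((p m).1 y)
  rw [norm_one, norm_sub_rev] at h2
  linarith [hyn m]

/-- Bounded sequences in a reflexive space converge weakly along every ultrafilter. -/
theorem IsReflexiveSpace.exists_forall_tendsto (hE : IsReflexiveSpace 𝕜 E) {ι : Type*}
    (U : Ultrafilter ι) {x : ι → E} {R : ℝ} (hx : ∀ n, ‖x n‖ ≤ R) :
    ∃ y : E, ∀ f : StrongDual 𝕜 E, Tendsto (fun n => f (x n)) U (𝓝 (f y)) := by
  let K := WeakDual.toStrongDual ⁻¹' Metric.closedBall (0 : StrongDual 𝕜 (StrongDual 𝕜 E)) R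
  let j : ι → WeakDual 𝕜 (StrongDual 𝕜 E) := fun n =>
    StrongDual.toWeakDual (NormedSpace.inclusionInDoubleDual 𝕜 E (x n))
  have hj : ∀ n, j n ∈ K := fun n => by
    simpa [K, j] using (NormedSpace.double_dual_bound 𝕜 E (x n)).trans (hx n)
  obtain ⟨z, -, hz⟩ := (WeakDual.isCompact_closedBall (𝕜 := 𝕜)
    (0 : StrongDual 𝕜 (StrongDual 𝕜 E)) R).ultrafilter_le_nhds (U.map j)
    (le_principal_iff.2 (Filter.mem_map.2 (Filter.univ_mem' hj)))
  obtain ⟨y, hy⟩ := hE (WeakDual.toStrongDual z)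
  refine ⟨y, fun f => ?_⟩
  have := ((WeakDual.eval_continuous f).tendsto z).comp (show Tendsto j U (𝓝 z) from hz)
  have hzf : z f = f y := by
    rw [← NormedSpace.dual_def 𝕜 E y f, hy]; rfl
  rw [← hzf]
  exact this

end Reflexivity

section Bidual

variable {𝕜 : Type*} [RCLike 𝕜] {X : Type*} [NormedAddCommGroup X] [NormedSpace 𝕜 X]

/-- The second adjoint of the inclusion of a subspace. -/
noncomputable def Submodule.bidualInclusion (Y : Submodule 𝕜 X) :
    StrongDual 𝕜 (StrongDual 𝕜 Y) →L[𝕜] StrongDual 𝕜 (StrongDual 𝕜 X) :=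
  ContinuousLinearMap.precomp 𝕜 (ContinuousLinearMap.precomp 𝕜 Y.subtypeL)

theorem Submodule.bidualInclusion_apply (Y : Submodule 𝕜 X) (w : StrongDual 𝕜 (StrongDual 𝕜 Y))
    (f : StrongDual 𝕜 X) : Y.bidualInclusion w f = w (f.comp Y.subtypeL) :=
  rfl

theorem Submodule.bidualInclusion_inclusionInDoubleDual (Y : Submodule 𝕜 X) (y : Y) :
    Y.bidualInclusion (NormedSpace.inclusionInDoubleDual 𝕜 Y y) =
      NormedSpace.inclusionInDoubleDual 𝕜 X y :=
  rfl

/-- An element of the bidual that annihilates the annihilator of `Y` comes from the bidual of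
`Y`, without increase of the norm. -/
theorem Submodule.exists_bidualInclusion_eq (Y : Submodule 𝕜 X)
    (z : StrongDual 𝕜 (StrongDual 𝕜 X))
    (hz : ∀ f : StrongDual 𝕜 X, (∀ y ∈ Y, f y = 0) → z f = 0) :
    ∃ w : StrongDual 𝕜 (StrongDual 𝕜 Y), ‖w‖ ≤ ‖z‖ ∧ Y.bidualInclusion w = z := by
  -- The choice `e` need not be linear, but by `hz` the value of `z` does not depend on the
  -- extension.
  choose e he hen using fun g : StrongDual 𝕜 Y => exists_extension_norm_eq Y g
  have hze : ∀ (g : StrongDual 𝕜 Y) (f : StrongDual 𝕜 X), (∀ y : Y, f y = g y) →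
      z (e g) = z f := fun g f hf => by
    rw [← sub_eq_zero, ← map_sub]
    exact hz _ fun y hy => by simp [he g ⟨y, hy⟩, hf ⟨y, hy⟩]
  let w : StrongDual 𝕜 (StrongDual 𝕜 Y) := LinearMap.mkContinuous
    { toFun := fun g => z (e g)
      map_add' := fun g h => by
        rw [← map_add]
        exact hze _ _ fun y => by simp [he]
      map_smul' := fun c g => by
        rw [RingHom.id_apply, ← map_smul]
        exact hze _ _ fun y => by simp [he] }
    ‖z‖ fun g => by simpa [hen] using z.le_opNorm (e g)
  refine ⟨w, LinearMap.mkContinuous_norm_le _ (norm_nonneg z) _, ?_⟩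
  ext f
  exact hze _ f fun y => rfl

end Bidual

theorem theorem2p4 {𝕜 : Type*} [RCLike 𝕜] {X : Type*} [NormedAddCommGroup X] [NormedSpace 𝕜 X]
    [CompleteSpace X] (hX : IsWeakStarSeqDenseInBidual 𝕜 X)
    (hsep : ∀ Y : Submodule 𝕜 X, IsClosed (Y : Set X) →
      TopologicalSpace.IsSeparable (Y : Set X) → IsCoreflexive 𝕜 Y) :
    IsCoreflexive 𝕜 X := by
  refine isReflexiveSpace_of_forall_bounded_seq fun q R hq => ?_
  choose z hzq hzn using fun n => Submodule.Quotient.norm_mk_lt (q n) one_pos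
  choose x hx using fun n => hX (z n)
  let Y : Submodule 𝕜 X :=
    (Submodule.span 𝕜 (Set.range fun p : ℕ × ℕ => x p.1 p.2)).topologicalClosure
  have hxY : ∀ n k, x n k ∈ Y := fun n k =>
    Submodule.le_topologicalClosure _ (Submodule.subset_span ⟨(n, k), rfl⟩)
  have hYsep : TopologicalSpace.IsSeparable (Y : Set X) := by
    rw [Submodule.topologicalClosure_coe]
    exact ((Set.countable_range _).isSeparable.span (R := 𝕜)).closure
  -- A w*-limit of points of `Y` vanishes on the annihilator of `Y`.
  have hz : ∀ n, ∃ w : StrongDual 𝕜 (StrongDual 𝕜 Y), ‖w‖ ≤ ‖z n‖ ∧ Y.bidualInclusion w = z n := by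
    refine fun n => Y.exists_bidualInclusion_eq (z n) fun f hf => ?_
    have h1 : Tendsto (fun k => f (x n k)) atTop (𝓝 (z n f)) :=
      ((WeakDual.eval_continuous f).tendsto _).comp (hx n)
    simp only [hf _ (hxY n _)] at h1
    exact tendsto_nhds_unique h1 tendsto_const_nhds
  choose w hwn hw using hz
  have hle : canonicalImage 𝕜 Y ≤ ((canonicalImage 𝕜 X).mkQL.comp Y.bidualInclusion).ker := by
    rintro _ ⟨y, rfl⟩
    exact (Submodule.Quotient.mk_eq_zero _).2 ⟨(y : X), rfl⟩
  let T := (canonicalImage 𝕜 Y).liftQL _ hle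
  have hT : ∀ n, T ((canonicalImage 𝕜 Y).mkQ (w n)) = q n := fun n => by
    simp [T, hw, hzq]
  obtain ⟨ρ, hρ⟩ := (hsep Y (Submodule.isClosed_topologicalClosure _)
    hYsep).exists_forall_tendsto (hyperfilter ℕ)
    (x := fun n => (canonicalImage 𝕜 Y).mkQ (w n)) (R := R + 1) fun n =>
      ((Submodule.Quotient.norm_mk_le _ _).trans (hwn n)).trans
        ((hzn n).le.trans (by linarith [hq n]))
  refine ⟨T ρ, fun f => ?_⟩
  exact (hρ (f.comp T)).congr fun n => congrArg f (hT n)
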